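/- Let $n \ge 0$ and let $P$ be a set partition of $[n] = \{1, \dots, n\}$. The arcs of $P$ are the pairs $(i,j)$ with $i<j$ such that $i$ and $j$ are consecutive elements, in numerical order, of a block of $P$. Write the arcs as $(i_1,j_1), \dots, (i_t,j_t)$ with $j_1 < j_2 < \cdots < j_t$, and let $\alpha(P)$ be the sequence $i_1 i_2 \cdots i_t$. Let $\mathrm{Ne}(P)$ be the graph whose vertices are the arcs of $P$, where two arcs are adjacent if and only if they can be named $(i,j)$ and $(i',j')$ so that $i < i' < j' < j$. For an integer $r \ge 0$ let $\mathrm{ne}_r(P)$ be the maximal number of vertices in a union of $r$ cliques of $\mathrm{Ne}(P)$, that is, the maximal number of arcs in a union of $r$ nestings of $P$ (the empty set and single arcs count as cliques). Let $\lambda$ be the shape of $\alpha(P)$, i.e. the shape of the insertion tableau obtained by inserting the terms of $\alpha(P)$ from left to right by RSK row insertion, and let $\lambda' = (\lambda'_1, \lambda'_2, \dots)$ be the conjugate of $\lambda$, with $\lambda'_i = 0$ for $i > \lambda_1$. Then $$\mathrm{ne}_r(P) = \lambda'_1 + \lambda'_2 + \cdots + \lambda'_r .$$ -/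

import Mathlib

namespace SetPartition

/-! ### Standard representation of a set partition of `[n] = {1, …, n}` -/

/-- The arcs `(i, j)`, `i < j`, of the standard representation of a partition `P` of `[n]`:
`i` and `j` are consecutive elements (in numerical order) of a block of `P`. -/
def arcs {n : ℕ} (P : Finpartition (Finset.Icc 1 n)) : Finset (ℕ × ℕ) :=
  (Finset.Icc 1 n ×ˢ Finset.Icc 1 n).filter fun e =>
    e.1 < e.2 ∧ ∃ B ∈ P.parts, e.1 ∈ B ∧ e.2 ∈ B ∧ ∀ k ∈ B, ¬ (e.1 < k ∧ k < e.2)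

/-- The arcs of `P`, listed by increasing right endpoint. (The sort is lexicographic in
`(j, i)`; distinct arcs have distinct right endpoints, so the tie-break is never used.) -/
def arcList {n : ℕ} (P : Finpartition (Finset.Icc 1 n)) : List (ℕ × ℕ) :=
  (((arcs P).image fun e => toLex (e.2, e.1)).sort (· ≤ ·)).map
    fun x => ((ofLex x).2, (ofLex x).1)

/-- The sequence `α(P) = i₁ i₂ ⋯ i_t` of left endpoints of the arcs `(i₁, j₁), …, (i_t, j_t)`
of `P`, where `j₁ < j₂ < ⋯ < j_t`. -/
def alpha {n : ℕ} (P : Finpartition (Finset.Icc 1 n)) : List ℕ :=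
  (arcList P).map Prod.fst

/-- The graph `Ne(P)`: its vertices are the arcs of `P`, and two arcs are adjacent iff they
are nested, that is, after naming them suitably, `i_r < i_s < j_s < j_r`. Its cliques are the
nestings of `P` (the empty set and single arcs being cliques). -/
def nestingGraph {n : ℕ} (P : Finpartition (Finset.Icc 1 n)) :
    SimpleGraph {e : ℕ × ℕ // e ∈ arcs P} where
  Adj e f := (e.1.1 < f.1.1 ∧ f.1.1 < f.1.2 ∧ f.1.2 < e.1.2) ∨
    (f.1.1 < e.1.1 ∧ e.1.1 < e.1.2 ∧ e.1.2 < f.1.2)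
  symm := ⟨fun _ _ h => h.symm⟩
  loopless := ⟨fun _ h => h.elim (fun h => lt_irrefl _ h.1) fun h => lt_irrefl _ h.1⟩

instance {n : ℕ} (P : Finpartition (Finset.Icc 1 n)) : DecidableRel (nestingGraph P).Adj :=
  fun _ _ => inferInstanceAs (Decidable (_ ∨ _))

/-- `ne_r(P)`: the maximal number of vertices in a union of `r` cliques of `Ne(P)`.
The maximum is over a finite nonempty set of families `C` of `r` cliques
(not necessarily distinct, and possibly empty). -/
def ne {n : ℕ} (r : ℕ) (P : Finpartition (Finset.Icc 1 n)) : ℕ :=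
  ((Finset.univ : Finset (Fin r → Finset {e : ℕ × ℕ // e ∈ arcs P})).filter
    fun C => ∀ k, (nestingGraph P).IsClique (C k)).sup
    fun C => (Finset.univ.biUnion C).card

end SetPartition

/-! ### Row insertion and the shape of a word -/

namespace RSK

/-- Insert `k` in a row: it replaces the leftmost entry larger than `k`, and that entry is
bumped; if there is none, `k` is put at the end of the row and nothing is bumped.
Returns the new row and the bumped entry. -/
def insertRow (k : ℕ) : List ℕ → List ℕ × Option ℕ
  | [] => ([k], none)
  | a :: l =>
    if k < a then (k :: l, some a) else (a :: (insertRow k l).1, (insertRow k l).2)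

/-- Row insertion `T ← k` of `k` in a tableau `T`, given as the list of its rows from top to
bottom: an entry bumped from a row is inserted in the next row. -/
def insert : List (List ℕ) → ℕ → List (List ℕ)
  | [], k => [[k]]
  | row :: T, k =>
    match insertRow k row with
    | (row', none) => row' :: T
    | (row', some b) => row' :: insert T b

/-- The insertion tableau `A(w)` of a word `w`: insert its letters from left to right,
starting from the empty tableau. -/
def insertionTableau (w : List ℕ) : List (List ℕ) :=
  w.foldl insert []

/-- Row `s` fits below row `r`: it is not longer, and columns are strictly increasing. -/
def Above : List ℕ → List ℕ → Prop
  | _, [] => True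
  | [], _ :: _ => False
  | a :: r, b :: s => a < b ∧ Above r s

theorem Above.length_le : ∀ {r s : List ℕ}, Above r s → s.length ≤ r.length
  | _, [], _ => by simp
  | [], _ :: _, h => h.elim
  | _ :: _, _ :: _, h => Nat.succ_le_succ (Above.length_le h.2)

theorem Above.insertRow_left (k : ℕ) :
    ∀ {r s : List ℕ}, Above r s → Above (insertRow k r).1 s
  | _, [], _ => by simp [Above]
  | [], _ :: _, h => h.elim
  | a :: r, b :: s, h => by
    by_cases hk : k < a
    · simp only [insertRow, hk, if_true]
      exact ⟨hk.trans h.1, h.2⟩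
    · simp only [insertRow, hk, if_false]
      exact ⟨h.1, Above.insertRow_left k h.2⟩

theorem lt_of_insertRow {k b : ℕ} : ∀ {r : List ℕ}, (insertRow k r).2 = some b → k < b
  | [], h => by simp [insertRow] at h
  | a :: r, h => by
    by_cases hk : k < a
    · simp only [insertRow, hk, if_true, Option.some.injEq] at h
      omega
    · simp only [insertRow, hk, if_false] at h
      exact lt_of_insertRow h

theorem Above.insertRow_insertRow {k b : ℕ} : ∀ {r s : List ℕ}, Above r s →
    (insertRow k r).2 = some b → Above (insertRow k r).1 (insertRow b s).1
  | [], _, _, hb => by simp [insertRow] at hb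
  | a :: r, s, h, hb => by
    by_cases hk : k < a
    · simp only [insertRow, hk, if_true, Option.some.injEq] at hb ⊢
      subst hb
      cases s with
      | nil => exact ⟨hk, by simp [Above]⟩
      | cons c s =>
        simp only [insertRow, h.1, if_true]
        exact ⟨hk, h.2⟩
    · simp only [insertRow, hk, if_false] at hb ⊢
      have hkb := lt_of_insertRow hb
      cases s with
      | nil => exact ⟨by omega, by simp [Above]⟩
      | cons c s =>
        by_cases hc : b < c
        · simp only [insertRow, hc, if_true]
          exact ⟨by omega, h.2.insertRow_left k⟩
        · simp only [insertRow, hc, if_false]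
          exact ⟨h.1, h.2.insertRow_insertRow hb⟩

theorem isChain_insert : ∀ {T : List (List ℕ)} (k : ℕ), T.IsChain Above →
    (insert T k).IsChain Above
  | [], k, _ => by simp [insert]
  | [row], k, _ => by
    rcases hr : insertRow k row with ⟨row', _ | b⟩
    · simp [insert, hr]
    · have h := Above.insertRow_insertRow (k := k) (b := b) (r := row) (s := [])
        (by simp [Above]) (by rw [hr])
      simpa [insert, hr, insertRow] using h
  | row :: row₂ :: T, k, hT => by
    rw [List.isChain_cons_cons] at hT
    rcases hr : insertRow k row with ⟨row', _ | b⟩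
    · have h := hT.1.insertRow_left k
      rw [hr] at h
      simpa [insert, hr] using ⟨h, hT.2⟩
    · have h := hT.1.insertRow_insertRow (k := k) (b := b) (by rw [hr])
      have ih := isChain_insert b hT.2
      rw [hr] at h
      rcases hr₂ : insertRow b row₂ with ⟨row₂', _ | c⟩ <;>
        simp only [insert, hr, hr₂] at h ih ⊢ <;>
        exact List.isChain_cons_cons.2 ⟨h, ih⟩

theorem isChain_insertionTableau (w : List ℕ) : (insertionTableau w).IsChain Above := by
  have h : ∀ (w : List ℕ) (T : List (List ℕ)), T.IsChain Above →
      (w.foldl insert T).IsChain Above := by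
    intro w
    induction w with
    | nil => exact fun T hT => hT
    | cons a w ih => exact fun T hT => ih _ (isChain_insert a hT)
  exact h w [] List.isChain_nil

theorem sortedGE_lengths (w : List ℕ) :
    ((insertionTableau w).map List.length).SortedGE := by
  have h : ((insertionTableau w).map List.length).IsChain (· ≥ ·) := by
    rw [List.isChain_map]
    exact (isChain_insertionTableau w).imp fun _ _ h => h.length_le
  exact List.sortedGE_iff_isChain.2 h

/-- The shape `λ` of a word `w`: the Young diagram whose row lengths `λ₁ ≥ λ₂ ≥ ⋯` are those
of the insertion tableau of `w`. -/
def shape (w : List ℕ) : YoungDiagram :=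
  YoungDiagram.ofRowLens ((insertionTableau w).map List.length) (sortedGE_lengths w)

end RSK

/-! When arcs are read by increasing right endpoint, two of them are nested exactly when the earlier
one has the larger left endpoint. So nestings of P are strictly decreasing subsequences of α(P).
Overlapping cliques can be made disjoint without changing their union, and the claim becomes
Greene's theorem for r disjoint decreasing subsequences.

For Greene's theorem, the attainable total sizes are invariant under Knuth moves
(`HasDecreasingFamily.swap`, `swap_after`, `swap_before`), and row insertion is a chain of such
moves on reading words (`decreasingEquiv_insert`). A word may thus be replaced by the reading word
of its tableau. There a weakly increasing row meets each decreasing subsequence at most once, so it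
contributes at most min(r, length) letters (`HasDecreasingFamily.le_sum`), and the first r columns
attain this bound in every row at once (`hasDecreasingFamily_readingWord`). Counting the cells of
these columns by column gives the sum of conjugate parts. -/

namespace RSK

/-! ### Families of strictly decreasing subsequences of a word -/

/-- In a word whose letters carry optional colours, two letters of the same colour are
strictly decreasing. -/
def ColourCompat (r : ℕ) (p q : ℕ × Option (Fin r)) : Prop :=
  p.2.isSome → p.2 = q.2 → q.1 < p.1

/-- There are `r` disjoint strictly decreasing subsequences of `w` with `m` letters in total.
The subsequences are given by a partial colouring of the letters. -/
def HasDecreasingFamily (r m : ℕ) (w : List ℕ) : Prop :=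
  ∃ l : List (ℕ × Option (Fin r)), l.map Prod.fst = w ∧ l.Pairwise (ColourCompat r) ∧
    l.countP (fun p => p.2.isSome) = m

/-- Since x ≤ z, the two letters never share a colour, so their relative order imposes no
constraint. -/
theorem HasDecreasingFamily.swap {r m : ℕ} {u v : List ℕ} {x z : ℕ} (hxz : x ≤ z)
    (h : HasDecreasingFamily r m (u ++ x :: z :: v)) :
    HasDecreasingFamily r m (u ++ z :: x :: v) := by
  obtain ⟨l, hl, hp, hm⟩ := h
  obtain ⟨lu, l, rfl, rfl, h₁⟩ := List.map_eq_append_iff.1 hl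
  obtain ⟨⟨x, cx⟩, l, rfl, rfl, h₂⟩ := List.map_eq_cons_iff.1 h₁
  obtain ⟨⟨z, cz⟩, lv, rfl, rfl, rfl⟩ := List.map_eq_cons_iff.1 h₂
  refine ⟨lu ++ (z, cz) :: (x, cx) :: lv, by simp, ?_, ?_⟩
  · simp only [List.pairwise_append, List.pairwise_cons, List.mem_cons, ColourCompat] at hp ⊢
    grind
  · simp only [List.countP_append, List.countP_cons] at hm ⊢
    omega

/-- Exchange two colours. -/
def swapColours {r : ℕ} (d e : Fin r) (p : ℕ × Option (Fin r)) : ℕ × Option (Fin r) :=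
  (p.1, p.2.map (Equiv.swap d e))

theorem countP_map_swapColours {r : ℕ} (d e : Fin r) (l : List (ℕ × Option (Fin r))) :
    (l.map (swapColours d e)).countP (fun p => p.2.isSome) =
      l.countP (fun p => p.2.isSome) := by
  simp [List.countP_map, Function.comp_def, swapColours]

theorem pairwise_map_swapColours {r : ℕ} (d e : Fin r) {l : List (ℕ × Option (Fin r))}
    (h : l.Pairwise (ColourCompat r)) :
    (l.map (swapColours d e)).Pairwise (ColourCompat r) := by
  rw [List.pairwise_map]
  refine h.imp fun {p q} hpq h1 h2 => hpq (by simpa [swapColours] using h1) ?_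
  exact Option.map_injective (Equiv.swap d e).injective h2

theorem swapColours_snd_eq_some {r : ℕ} {d e c : Fin r} {p : ℕ × Option (Fin r)} :
    (swapColours d e p).2 = some c ↔ p.2 = some (Equiv.swap d e c) := by
  simp only [swapColours, Option.map_eq_some_iff]
  constructor
  · rintro ⟨a, ha, rfl⟩
    simpa using ha
  · exact fun h => ⟨_, h, by simp⟩

theorem colourCompat_iff {r : ℕ} {p q : ℕ × Option (Fin r)} :
    ColourCompat r p q ↔ ∀ c, p.2 = some c → q.2 = some c → q.1 < p.1 := by
  constructor
  · exact fun h c h1 h2 => h (by simp [h1]) (h1.trans h2.symm)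
  · intro h h1 h2
    obtain ⟨c, hc⟩ := Option.isSome_iff_exists.1 h1
    exact h c hc (h2 ▸ hc)

/-- The old colouring fails only if z and x share a colour d. Then y, which lies between them in
value, makes a repair possible. -/
theorem HasDecreasingFamily.swap_after {r m : ℕ} {u v : List ℕ} {x y z : ℕ}
    (hxy : x < y) (hyz : y ≤ z) (h : HasDecreasingFamily r m (u ++ y :: z :: x :: v)) :
    HasDecreasingFamily r m (u ++ y :: x :: z :: v) := by
  obtain ⟨l, hl, hp, hm⟩ := h
  obtain ⟨lu, l, rfl, rfl, h₁⟩ := List.map_eq_append_iff.1 hl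
  obtain ⟨⟨y, cy⟩, l, rfl, rfl, h₂⟩ := List.map_eq_cons_iff.1 h₁
  obtain ⟨⟨z, cz⟩, l, rfl, rfl, h₃⟩ := List.map_eq_cons_iff.1 h₂
  obtain ⟨⟨x, cx⟩, lv, rfl, rfl, rfl⟩ := List.map_eq_cons_iff.1 h₃
  simp only [List.countP_append, List.countP_cons] at hm
  simp only [List.pairwise_append, List.pairwise_cons, List.mem_cons, colourCompat_iff,
    forall_eq_or_imp] at hp
  by_cases hc : ∃ d, cz = some d ∧ cx = some d
  · obtain ⟨d, rfl, rfl⟩ := hc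
    rcases cy with _ | e
    -- With y uncoloured, y takes the place of z in the subsequence d.
    · refine ⟨lu ++ (y, some d) :: (x, some d) :: (z, none) :: lv, by simp, ?_, ?_⟩
      · simp only [List.pairwise_append, List.pairwise_cons, List.mem_cons, colourCompat_iff,
          forall_eq_or_imp]
        grind
      · simp only [List.countP_append, List.countP_cons]
        simp at hm ⊢
        omega
    -- The two subsequences exchange tails: e continues from y through x into the old tail of d, and
    -- d continues from z into the old tail of e, whose letters are below y ≤ z.
    · refine ⟨lu ++ (y, some e) :: (x, some e) :: (z, some d) :: lv.map (swapColours d e),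
        by simp [swapColours], ?_, ?_⟩
      · have hv := pairwise_map_swapColours d e (l := lv) hp.2.1.2.2.2
        simp only [List.pairwise_append, List.pairwise_cons, List.mem_cons, colourCompat_iff,
          forall_eq_or_imp, List.forall_mem_map, swapColours_snd_eq_some] at hv ⊢
        simp only [swapColours] at hv ⊢
        refine ⟨hp.1, ?_, ?_⟩ <;> grind
      · simp only [List.countP_append, List.countP_cons, countP_map_swapColours]
        simp at hm ⊢
        omega
  · refine ⟨lu ++ (y, cy) :: (x, cx) :: (z, cz) :: lv, by simp, ?_, ?_⟩
    · simp only [List.pairwise_append, List.pairwise_cons, List.mem_cons, colourCompat_iff,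
        forall_eq_or_imp]
      grind
    · simp only [List.countP_append, List.countP_cons]
      omega

/-- The same repair: y replaces x after z in the subsequence d. If y had colour e, then x takes its
place in e and the tails of d and e are exchanged. -/
theorem HasDecreasingFamily.swap_before {r m : ℕ} {u v : List ℕ} {x y z : ℕ}
    (hxy : x ≤ y) (hyz : y < z) (h : HasDecreasingFamily r m (u ++ z :: x :: y :: v)) :
    HasDecreasingFamily r m (u ++ x :: z :: y :: v) := by
  obtain ⟨l, hl, hp, hm⟩ := h
  obtain ⟨lu, l, rfl, rfl, h₁⟩ := List.map_eq_append_iff.1 hl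
  obtain ⟨⟨z, cz⟩, l, rfl, rfl, h₂⟩ := List.map_eq_cons_iff.1 h₁
  obtain ⟨⟨x, cx⟩, l, rfl, rfl, h₃⟩ := List.map_eq_cons_iff.1 h₂
  obtain ⟨⟨y, cy⟩, lv, rfl, rfl, rfl⟩ := List.map_eq_cons_iff.1 h₃
  simp only [List.countP_append, List.countP_cons] at hm
  simp only [List.pairwise_append, List.pairwise_cons, List.mem_cons, colourCompat_iff,
    forall_eq_or_imp] at hp
  by_cases hc : ∃ d, cz = some d ∧ cx = some d
  · obtain ⟨d, rfl, rfl⟩ := hc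
    rcases cy with _ | e
    · refine ⟨lu ++ (x, none) :: (z, some d) :: (y, some d) :: lv, by simp, ?_, ?_⟩
      · simp only [List.pairwise_append, List.pairwise_cons, List.mem_cons, colourCompat_iff,
          forall_eq_or_imp]
        grind
      · simp only [List.countP_append, List.countP_cons]
        simp at hm ⊢
        omega
    · refine ⟨lu ++ (x, some e) :: (z, some d) :: (y, some d) :: lv.map (swapColours d e),
        by simp [swapColours], ?_, ?_⟩
      · have hv := pairwise_map_swapColours d e (l := lv) hp.2.1.2.2.2
        simp only [List.pairwise_append, List.pairwise_cons, List.mem_cons, colourCompat_iff,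
          forall_eq_or_imp, List.forall_mem_map, swapColours_snd_eq_some] at hv ⊢
        simp only [swapColours] at hv ⊢
        refine ⟨hp.1, ?_, ?_⟩ <;> grind
      · simp only [List.countP_append, List.countP_cons, countP_map_swapColours]
        simp at hm ⊢
        omega
  · refine ⟨lu ++ (x, cx) :: (z, cz) :: (y, cy) :: lv, by simp, ?_, ?_⟩
    · simp only [List.pairwise_append, List.pairwise_cons, List.mem_cons, colourCompat_iff,
        forall_eq_or_imp]
      grind
    · simp only [List.countP_append, List.countP_cons]
      omega

/-! ### Row insertion and decreasing families -/

/-- Two words are equivalent if, in every context, they have decreasing families of the same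
sizes. Knuth equivalent words are equivalent in this sense. -/
def DecreasingEquiv (w w' : List ℕ) : Prop :=
  ∀ r m u v, HasDecreasingFamily r m (u ++ w ++ v) ↔ HasDecreasingFamily r m (u ++ w' ++ v)

namespace DecreasingEquiv

theorem refl (w : List ℕ) : DecreasingEquiv w w := fun _ _ _ _ => Iff.rfl

theorem trans {a b c : List ℕ} (h : DecreasingEquiv a b) (h' : DecreasingEquiv b c) :
    DecreasingEquiv a c := fun r m u v => (h r m u v).trans (h' r m u v)

theorem append_left (s : List ℕ) {a b : List ℕ} (h : DecreasingEquiv a b) :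
    DecreasingEquiv (s ++ a) (s ++ b) := fun r m u v => by
  simpa using h r m (u ++ s) v

theorem append_right {a b : List ℕ} (h : DecreasingEquiv a b) (s : List ℕ) :
    DecreasingEquiv (a ++ s) (b ++ s) := fun r m u v => by
  simpa using h r m u (s ++ v)

theorem knuth_after {x y z : ℕ} (hxy : x < y) (hyz : y ≤ z) (s : List ℕ) :
    DecreasingEquiv (y :: z :: x :: s) (y :: x :: z :: s) := fun r m u v => by
  constructor <;> intro h
  · simpa using HasDecreasingFamily.swap_after (v := s ++ v) hxy hyz (by simpa using h)
  · simpa using HasDecreasingFamily.swap (u := u ++ [y]) (v := s ++ v) (hxy.le.trans hyz)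
      (by simpa using h)

theorem knuth_before {x y z : ℕ} (hxy : x ≤ y) (hyz : y < z) (s : List ℕ) :
    DecreasingEquiv (x :: z :: y :: s) (z :: x :: y :: s) := fun r m u v => by
  constructor <;> intro h
  · simpa using HasDecreasingFamily.swap (u := u) (v := y :: s ++ v) (hxy.trans hyz.le)
      (by simpa using h)
  · simpa using HasDecreasingFamily.swap_before (v := s ++ v) hxy hyz (by simpa using h)

/-- The letter k travels left through l, each step being a Knuth move witnessed by the letter just
before the pair. -/
theorem cons_append_singleton {k : ℕ} : ∀ {a : ℕ} {l : List ℕ}, k < a →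
    (a :: l).Pairwise (· ≤ ·) → DecreasingEquiv (a :: l ++ [k]) (a :: k :: l)
  | a, [], _, _ => refl _
  | a, b :: l, hk, h => by
    rw [List.pairwise_cons] at h
    have hab := h.1 b (by simp)
    exact ((cons_append_singleton (hk.trans_le hab) h.2).append_left [a]).trans
      (knuth_after hk hab l)

/-- Once k has reached its place, the bumped b travels left to the front. Each move is witnessed by
the letter just after the pair, which is less than b. -/
theorem insertRow {k b : ℕ} : ∀ {l : List ℕ}, l.Pairwise (· ≤ ·) →
    (RSK.insertRow k l).2 = some b → DecreasingEquiv (l ++ [k]) (b :: (RSK.insertRow k l).1)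
  | [], _, hb => by simp [RSK.insertRow] at hb
  | a :: l, h, hb => by
    by_cases hk : k < a
    · simp only [RSK.insertRow, hk, if_true, Option.some.injEq] at hb ⊢
      subst hb
      exact cons_append_singleton hk h
    · simp only [RSK.insertRow, hk, if_false] at hb ⊢
      have hkb := lt_of_insertRow hb
      rw [List.pairwise_cons] at h
      refine ((insertRow h.2 hb).append_left [a]).trans ?_
      cases l with
      | nil => simp [RSK.insertRow] at hb
      | cons c l =>
        by_cases hc : k < c
        · simp only [RSK.insertRow, hc, if_true]
          exact knuth_before (by omega) hkb _
        · simp only [RSK.insertRow, hc, if_false]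
          exact knuth_before (h.1 c (by simp)) (by omega) _

end DecreasingEquiv

theorem insertRow_of_none {k : ℕ} : ∀ {l : List ℕ}, (insertRow k l).2 = none →
    (insertRow k l).1 = l ++ [k]
  | [], _ => rfl
  | a :: l, h => by
    by_cases hk : k < a
    · simp [insertRow, hk] at h
    · simp only [insertRow, hk, if_false] at h ⊢
      rw [insertRow_of_none h, List.cons_append]

theorem mem_insertRow {k c : ℕ} : ∀ {l : List ℕ}, c ∈ (insertRow k l).1 → c = k ∨ c ∈ l
  | [], h => by simpa [insertRow] using h
  | a :: l, h => by
    by_cases hk : k < a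
    · simp only [insertRow, hk, if_true, List.mem_cons] at h ⊢
      tauto
    · simp only [insertRow, hk, if_false, List.mem_cons] at h ⊢
      rcases h with h | h
      · exact .inr (.inl h)
      · have := mem_insertRow h
        tauto

theorem pairwise_insertRow (k : ℕ) : ∀ {l : List ℕ}, l.Pairwise (· ≤ ·) →
    (insertRow k l).1.Pairwise (· ≤ ·)
  | [], _ => by simp [insertRow]
  | a :: l, h => by
    rw [List.pairwise_cons] at h
    by_cases hk : k < a
    · simp only [insertRow, hk, if_true, List.pairwise_cons]
      exact ⟨fun c hc => hk.le.trans (h.1 c hc), h.2⟩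
    · simp only [insertRow, hk, if_false, List.pairwise_cons]
      refine ⟨fun c hc => ?_, pairwise_insertRow k h.2⟩
      rcases mem_insertRow hc with rfl | hc
      · omega
      · exact h.1 c hc

/-- The row reading word of a tableau: its rows are read from bottom to top. -/
def readingWord (T : List (List ℕ)) : List ℕ := T.reverse.flatten

theorem readingWord_cons (row : List ℕ) (T : List (List ℕ)) :
    readingWord (row :: T) = readingWord T ++ row := by
  simp [readingWord]

theorem pairwise_insert : ∀ {T : List (List ℕ)} (k : ℕ),
    (∀ row ∈ T, row.Pairwise (· ≤ ·)) → ∀ row ∈ insert T k, row.Pairwise (· ≤ ·)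
  | [], k, _ => by simp [insert]
  | row :: T, k, h => by
    rw [List.forall_mem_cons] at h
    have hrow := pairwise_insertRow k h.1
    rcases hr : insertRow k row with ⟨row', _ | b⟩ <;> rw [hr] at hrow <;>
      simp only [insert, hr, List.forall_mem_cons]
    · exact ⟨hrow, h.2⟩
    · exact ⟨hrow, pairwise_insert b h.2⟩

theorem decreasingEquiv_insert : ∀ {T : List (List ℕ)} (k : ℕ),
    (∀ row ∈ T, row.Pairwise (· ≤ ·)) →
      DecreasingEquiv (readingWord T ++ [k]) (readingWord (insert T k))
  | [], k, _ => by simpa [insert, readingWord] using DecreasingEquiv.refl [k]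
  | row :: T, k, h => by
    rw [List.forall_mem_cons] at h
    rcases hr : insertRow k row with ⟨row', _ | b⟩ <;>
      simp only [insert, hr, readingWord_cons, List.append_assoc]
    · have := insertRow_of_none (k := k) (l := row) (by rw [hr])
      rw [hr] at this
      rw [← this]
      exact .refl _
    · have := DecreasingEquiv.insertRow (k := k) (b := b) h.1 (by rw [hr])
      rw [hr] at this
      refine (this.append_left _).trans ?_
      simpa using (decreasingEquiv_insert b h.2).append_right row'

theorem insertionTableau_concat (w : List ℕ) (k : ℕ) :
    insertionTableau (w ++ [k]) = insert (insertionTableau w) k := by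
  simp [insertionTableau]

theorem pairwise_insertionTableau (w : List ℕ) :
    ∀ row ∈ insertionTableau w, row.Pairwise (· ≤ ·) := by
  induction w using List.reverseRecOn with
  | nil => simp [insertionTableau]
  | append_singleton w k ih =>
    rw [insertionTableau_concat]
    exact pairwise_insert k ih

theorem decreasingEquiv_insertionTableau (w : List ℕ) :
    DecreasingEquiv w (readingWord (insertionTableau w)) := by
  induction w using List.reverseRecOn with
  | nil => exact .refl _
  | append_singleton w k ih =>
    rw [insertionTableau_concat]
    exact (ih.append_right [k]).trans
      (decreasingEquiv_insert k (pairwise_insertionTableau w))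

/-! ### Decreasing families of a tableau, and Greene's theorem -/

/-- A strictly decreasing subsequence has at most one letter in a weakly increasing row, so no
colour repeats. -/
theorem countP_isSome_le {r : ℕ} {l : List (ℕ × Option (Fin r))}
    (hs : (l.map Prod.fst).Pairwise (· ≤ ·)) (hp : l.Pairwise (ColourCompat r)) :
    l.countP (fun p => p.2.isSome) ≤ min r l.length := by
  refine le_min ?_ List.countP_le_length
  have hnd : (l.filterMap Prod.snd).Nodup := by
    rw [List.Nodup, List.pairwise_filterMap]
    refine (hp.and (List.pairwise_map.1 hs)).imp ?_
    rintro p q ⟨h1, h2⟩ c hc c' hc' rfl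
    exact absurd (colourCompat_iff.1 h1 c hc hc') (by omega)
  have hlen : (l.filterMap Prod.snd).length = l.countP (fun p => p.2.isSome) := by
    rw [List.length_filterMap_eq_countP]
  simpa [hlen] using hnd.length_le_card

theorem HasDecreasingFamily.le_sum {r : ℕ} : ∀ {T : List (List ℕ)} {m : ℕ},
    (∀ row ∈ T, row.Pairwise (· ≤ ·)) → HasDecreasingFamily r m (readingWord T) →
      m ≤ (T.map fun row => min r row.length).sum
  | [], m, _, ⟨l, hl, _, hm⟩ => by
    obtain rfl : l = [] := by simpa [readingWord] using hl
    simpa using hm.symm.le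
  | row :: T, m, hT, ⟨l, hl, hp, hm⟩ => by
    rw [List.forall_mem_cons] at hT
    rw [readingWord_cons] at hl
    obtain ⟨l₁, l₂, rfl, h₁, rfl⟩ := List.map_eq_append_iff.1 hl
    rw [List.pairwise_append] at hp
    rw [List.countP_append] at hm
    have ih := le_sum hT.2 ⟨l₁, h₁, hp.1, rfl⟩
    have := countP_isSome_le hT.1 hp.2.1
    simp only [List.map_cons, List.sum_cons, List.length_map]
    omega

theorem Above.getElem_lt : ∀ {a b : List ℕ}, Above a b → ∀ (i : ℕ) (ha : i < a.length)
    (hb : i < b.length), a[i] < b[i]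
  | _, [], _, _, _, hb => by simp at hb
  | [], _ :: _, h, _, _, _ => h.elim
  | _ :: _, _ :: _, h, 0, _, _ => h.1
  | _ :: _, _ :: _, h, i + 1, ha, hb => h.2.getElem_lt i (by simpa using ha) (by simpa using hb)

theorem Above.trans : ∀ {a b c : List ℕ}, Above a b → Above b c → Above a c
  | _, _, [], _, _ => by simp [Above]
  | _, [], _ :: _, _, h => h.elim
  | [], _ :: _, _ :: _, h, _ => h.elim
  | _ :: _, _ :: _, _ :: _, h, h' => ⟨h.1.trans h'.1, h.2.trans h'.2⟩

instance : IsTrans (List ℕ) Above := ⟨fun _ _ _ => Above.trans⟩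

/-- Colour the entries of a row in the first `r` columns by the column that they are in. -/
def colourRow (r : ℕ) (row : List ℕ) : List (ℕ × Option (Fin r)) :=
  row.zipIdx.map fun p => (p.1, if h : p.2 < r then some ⟨p.2, h⟩ else none)

theorem map_fst_colourRow (r : ℕ) (row : List ℕ) : (colourRow r row).map Prod.fst = row := by
  rw [colourRow, List.map_map]
  exact List.zipIdx_map_fst 0 row

theorem mem_colourRow {r : ℕ} {row : List ℕ} {p : ℕ × Option (Fin r)} {c : Fin r}
    (hp : p ∈ colourRow r row) (hc : p.2 = some c) : ∃ h : (c : ℕ) < row.length, p.1 = row[c] := by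
  obtain ⟨⟨a, i⟩, ha, rfl⟩ := List.mem_map.1 hp
  rw [List.mem_zipIdx_iff_getElem?, List.getElem?_eq_some_iff] at ha
  obtain ⟨h, ha⟩ := ha
  simp only at hc h ha
  split_ifs at hc with hi
  obtain rfl := Option.some.inj hc
  exact ⟨h, ha.symm⟩

theorem countP_colourRow (r : ℕ) (row : List ℕ) :
    (colourRow r row).countP (fun p => p.2.isSome) = min r row.length := by
  have h : ∀ n, (List.range n).countP (fun i => i < r) = min r n := fun n => by
    induction n with
    | zero => simp
    | succ n ih =>
      simp only [List.range_succ, List.countP_append, ih, List.countP_singleton, decide_eq_true_eq]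
      split_ifs <;> omega
  rw [← h, List.range_eq_range', ← List.zipIdx_map_snd 0 row, List.countP_map, colourRow,
    List.countP_map]
  refine List.countP_congr fun p _ => ?_
  by_cases hp : p.2 < r <;> simp [hp]

theorem pairwise_colourRow (r : ℕ) (row : List ℕ) :
    (colourRow r row).Pairwise (ColourCompat r) := by
  have h : (row.zipIdx.map Prod.snd).Nodup := by
    rw [List.zipIdx_map_snd]
    exact List.nodup_range'
  rw [colourRow, List.pairwise_map]
  refine (List.pairwise_map.1 h).imp fun {p q} hpq => colourCompat_iff.2 fun c hc hc' => ?_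
  simp only at hc hc'
  split_ifs at hc hc'
  exact absurd (congrArg Fin.val ((Option.some.inj hc).trans (Option.some.inj hc').symm)) hpq

/-- Rows are read from bottom to top, so each column becomes a strictly decreasing subsequence. -/
theorem hasDecreasingFamily_readingWord (r : ℕ) {T : List (List ℕ)} (hT : T.IsChain Above) :
    HasDecreasingFamily r (T.map fun row => min r row.length).sum (readingWord T) := by
  have hT' := List.isChain_iff_pairwise.1 hT
  clear hT
  refine ⟨(T.map (colourRow r)).reverse.flatten, ?_, ?_, ?_⟩
  · simp only [readingWord, List.map_flatten, List.map_reverse, List.map_map, Function.comp_def,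
      map_fst_colourRow, List.map_id']
  · rw [List.pairwise_flatten, List.pairwise_reverse, List.pairwise_map]
    refine ⟨?_, hT'.imp ?_⟩
    · simp only [List.mem_reverse, List.forall_mem_map]
      exact fun row _ => pairwise_colourRow r row
    · intro a b hab p hp q hq
      rw [colourCompat_iff]
      intro c hc hc'
      obtain ⟨h, hp⟩ := mem_colourRow hp hc
      obtain ⟨h', hq⟩ := mem_colourRow hq hc'
      rw [hp, hq]
      exact hab.getElem_lt _ _ _
  · simp only [List.countP_flatten, List.map_reverse, List.sum_reverse, List.map_map,
      Function.comp_def, countP_colourRow]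

/-! ### Column lengths of a Young diagram -/

theorem lt_countP_iff_of_pairwise {j : ℕ} : ∀ {w : List ℕ}, w.Pairwise (· ≥ ·) → ∀ i,
    i < w.countP (fun a => j < a) ↔ ∃ h : i < w.length, j < w[i]
  | [], _, i => by simp
  | a :: w, hw, i => by
    rw [List.pairwise_cons] at hw
    by_cases ha : j < a
    · cases i with
      | zero => simp [ha]
      | succ i => simpa [ha] using lt_countP_iff_of_pairwise hw.2 i
    · have h0 : (a :: w).countP (fun a => j < a) = 0 := by
        rw [List.countP_eq_zero]
        simp only [List.forall_mem_cons, decide_eq_true_eq]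
        exact ⟨ha, fun b hb => by have := hw.1 b hb; omega⟩
      rw [h0]
      refine iff_of_false (by omega) ?_
      rintro ⟨h, hj⟩
      rcases List.mem_cons.1 (List.getElem_mem h) with h' | h'
      · omega
      · have := hw.1 _ h'
        omega

theorem colLen_ofRowLens (w : List ℕ) (hw : w.SortedGE) (j : ℕ) :
    (YoungDiagram.ofRowLens w hw).colLen j = w.countP (fun a => j < a) := by
  refine eq_of_forall_lt_iff fun i => ?_
  rw [lt_countP_iff_of_pairwise hw.pairwise, ← YoungDiagram.mem_iff_lt_colLen,
    YoungDiagram.mem_ofRowLens]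

/-- The cells in the first r columns are counted by columns and by rows. -/
theorem sum_colLen_ofRowLens (r : ℕ) (w : List ℕ) (hw : w.SortedGE) :
    ∑ j ∈ Finset.range r, (YoungDiagram.ofRowLens w hw).colLen j =
      (w.map fun a => min r a).sum := by
  simp only [colLen_ofRowLens]
  clear hw
  induction w with
  | nil => simp
  | cons a w ih =>
    simp only [List.countP_cons, Finset.sum_add_distrib, ih, List.map_cons, List.sum_cons]
    rw [add_comm]
    congr 1
    clear ih
    induction r with
    | zero => simp
    | succ r ih =>
      rw [Finset.sum_range_succ, ih]
      simp only [decide_eq_true_eq]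
      split_ifs <;> omega

/-- Greene's theorem for decreasing subsequences. -/
theorem isGreatest_hasDecreasingFamily (r : ℕ) (w : List ℕ) :
    IsGreatest {m | HasDecreasingFamily r m w}
      (∑ i ∈ Finset.range r, (shape w).transpose.rowLen i) := by
  have hsum : ∑ i ∈ Finset.range r, (shape w).transpose.rowLen i =
      ((insertionTableau w).map fun row => min r row.length).sum := by
    simp only [YoungDiagram.rowLen_transpose, shape, sum_colLen_ofRowLens, List.map_map,
      Function.comp_def]
  have hiff : ∀ m, HasDecreasingFamily r m w ↔
      HasDecreasingFamily r m (readingWord (insertionTableau w)) := fun m => by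
    simpa using decreasingEquiv_insertionTableau w r m [] []
  rw [hsum]
  exact ⟨(hiff _).2 (hasDecreasingFamily_readingWord r (isChain_insertionTableau w)),
    fun m hm => ((hiff m).1 hm).le_sum (pairwise_insertionTableau w)⟩

end RSK

/-! ### Nestings of P as decreasing subsequences of α(P) -/

namespace SetPartition

open RSK

variable {n : ℕ} {P : Finpartition (Finset.Icc 1 n)}

theorem fst_lt_snd_of_mem_arcs {e : ℕ × ℕ} (he : e ∈ arcs P) : e.1 < e.2 :=
  (Finset.mem_filter.1 he).2.1

/-- Distinct arcs have distinct right endpoints. -/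
theorem arcs_eq_of_snd_eq {e f : ℕ × ℕ} (he : e ∈ arcs P) (hf : f ∈ arcs P)
    (h : e.2 = f.2) : e = f := by
  obtain ⟨-, he, B, hB, h₁, h₂, hk⟩ := Finset.mem_filter.1 he
  obtain ⟨-, hf, B', hB', h₁', h₂', hk'⟩ := Finset.mem_filter.1 hf
  obtain rfl : B = B' := P.eq_of_mem_parts hB hB' h₂ (h ▸ h₂')
  have := hk _ h₁'
  have := hk' _ h₁
  exact Prod.ext (by omega) h

theorem mem_arcList {e : ℕ × ℕ} : e ∈ arcList P ↔ e ∈ arcs P := by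
  obtain ⟨i, j⟩ := e
  simp [arcList]

theorem pairwise_arcList (P : Finpartition (Finset.Icc 1 n)) :
    (arcList P).Pairwise fun e f => e.2 < f.2 := by
  have h : (arcList P).Pairwise fun e f => e.2 < f.2 ∨ e.2 = f.2 ∧ e.1 < f.1 := by
    rw [arcList, List.pairwise_map]
    refine (Finset.sortedLT_sort _).pairwise.imp fun {p q} hpq => ?_
    rwa [Prod.Lex.lt_iff] at hpq
  refine h.imp_of_mem fun {e f} he hf hef => hef.resolve_right fun h' => ?_
  have := arcs_eq_of_snd_eq (mem_arcList.1 he) (mem_arcList.1 hf) h'.1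
  subst this
  exact lt_irrefl _ h'.2

theorem nodup_arcList (P : Finpartition (Finset.Icc 1 n)) : (arcList P).Nodup :=
  (pairwise_arcList P).imp fun h h' => by simp [h'] at h

theorem hasDecreasingFamily_of_isClique {r : ℕ}
    {C : Fin r → Finset {e : ℕ × ℕ // e ∈ arcs P}}
    (hC : ∀ k, (nestingGraph P).IsClique (C k)) :
    HasDecreasingFamily r (Finset.univ.biUnion C).card (alpha P) := by
  classical
  -- The cliques may overlap; each covered arc is assigned to just one clique containing it.
  have hcol : ∀ e : ℕ × ℕ, ∃ c : Option (Fin r),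
      (∀ k, c = some k → ∃ x ∈ C k, x.1 = e) ∧ (c.isSome ↔ ∃ k, ∃ x ∈ C k, x.1 = e) := by
    intro e
    by_cases h : ∃ k, ∃ x ∈ C k, x.1 = e
    · obtain ⟨k, hk⟩ := h
      exact ⟨some k, by simpa using hk, by simpa using ⟨k, by simpa using hk⟩⟩
    · exact ⟨none, by simp, by simpa using h⟩
  choose col hcol hsome using hcol
  refine ⟨(arcList P).map fun e => (e.1, col e), by simp [alpha], ?_, ?_⟩
  · rw [List.pairwise_map]
    refine (pairwise_arcList P).imp fun {e f} hef => colourCompat_iff.2 fun c hc hc' => ?_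
    obtain ⟨x, hx, rfl⟩ := hcol e c hc
    obtain ⟨y, hy, rfl⟩ := hcol f c hc'
    have hxy : x ≠ y := fun h => by simp [h] at hef
    rcases hC c hx hy hxy with h | h <;> omega
  · rw [List.countP_map, List.countP_eq_length_filter,
      ← List.toFinset_card_of_nodup ((nodup_arcList P).filter _),
      ← Finset.card_map (Function.Embedding.subtype _)]
    congr 1
    ext e
    simp only [List.mem_toFinset, List.mem_filter, mem_arcList, Function.comp_apply, hsome,
      Finset.mem_map, Finset.mem_biUnion, Finset.mem_univ, true_and,
      Function.Embedding.subtype_apply]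
    constructor
    · rintro ⟨-, k, x, hx, rfl⟩
      exact ⟨x, ⟨k, hx⟩, rfl⟩
    · rintro ⟨x, ⟨k, hx⟩, rfl⟩
      exact ⟨x.2, k, x, hx, rfl⟩

theorem exists_isClique_of_hasDecreasingFamily {r m : ℕ}
    (h : HasDecreasingFamily r m (alpha P)) :
    ∃ C : Fin r → Finset {e : ℕ × ℕ // e ∈ arcs P},
      (∀ k, (nestingGraph P).IsClique (C k)) ∧ (Finset.univ.biUnion C).card = m := by
  classical
  obtain ⟨l, hl, hp, rfl⟩ := h
  have hlen : l.length = (arcList P).length := by simpa [alpha] using congrArg List.length hl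
  /- The arcs with their colours. -/
  obtain ⟨L, hL₁, hL₂⟩ : ∃ L : List ((ℕ × ℕ) × Option (Fin r)),
      L.map Prod.fst = arcList P ∧ L.map (fun p => (p.1.1, p.2)) = l := by
    refine ⟨(arcList P).zip (l.map Prod.snd), List.map_fst_zip (by simp [hlen]), ?_⟩
    refine List.ext_getElem (by simp [hlen]) fun i hi hi' => ?_
    have := List.getElem_of_eq hl (i := i) (by simpa using hi')
    simp only [alpha, List.getElem_map] at this
    simp [← this]
  subst hL₂
  have hmem : ∀ p ∈ L, p.1 ∈ arcs P := fun p hpL =>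
    mem_arcList.1 (hL₁ ▸ List.mem_map_of_mem hpL)
  have hsorted : L.Pairwise fun p q => p.1.2 < q.1.2 := by
    have := pairwise_arcList P
    rwa [← hL₁, List.pairwise_map] at this
  have hadj : L.Pairwise fun p q => ∀ c, p.2 = some c → q.2 = some c →
      q.1.1 < p.1.1 ∧ p.1.2 < q.1.2 :=
    ((List.pairwise_map.1 hp).and hsorted).imp fun h c hc hc' =>
      ⟨colourCompat_iff.1 h.1 c hc hc', h.2⟩
  -- Cliques are unordered, so the relation along the list is symmetrised.
  have hadj' : ∀ p ∈ L, ∀ q ∈ L, p ≠ q → ∀ c, p.2 = some c → q.2 = some c →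
      (q.1.1 < p.1.1 ∧ p.1.2 < q.1.2) ∨ (p.1.1 < q.1.1 ∧ q.1.2 < p.1.2) := by
    intro p hpL q hqL hne
    refine List.Pairwise.forall_of_forall_of_flip (R := fun p q => p ≠ q → ∀ c, p.2 = some c →
      q.2 = some c → (q.1.1 < p.1.1 ∧ p.1.2 < q.1.2) ∨ (p.1.1 < q.1.1 ∧ q.1.2 < p.1.2))
      (fun _ _ h => absurd rfl h) (hadj.imp fun h _ c hc hc' => .inl (h c hc hc'))
      (hadj.imp fun h _ c hc hc' => .inr (h c hc' hc)) hpL hqL hne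
  refine ⟨fun k => Finset.univ.filter fun e => (e.1, some k) ∈ L, fun k => ?_, ?_⟩
  · intro e he f hf hef
    simp only [Finset.coe_filter, Finset.mem_univ, true_and, Set.mem_ofPred_eq] at he hf
    have := fst_lt_snd_of_mem_arcs e.2
    have := fst_lt_snd_of_mem_arcs f.2
    rcases hadj' _ he _ hf (fun h => hef (Subtype.ext (congrArg Prod.fst h))) k rfl rfl with h | h
    · exact .inr ⟨h.1, by omega, h.2⟩
    · exact .inl ⟨h.1, by omega, h.2⟩
  -- Each arc is listed once, so counting coloured positions counts the arcs in the union.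
  · have hnd : ((L.filter fun p => p.2.isSome).map Prod.fst).Nodup :=
      ((hL₁ ▸ nodup_arcList P : (L.map Prod.fst).Nodup)).sublist (List.filter_sublist.map _)
    have hcard : L.countP (fun p => p.2.isSome) =
        ((L.filter fun p => p.2.isSome).map Prod.fst).toFinset.card := by
      rw [List.toFinset_card_of_nodup hnd, List.length_map, List.countP_eq_length_filter]
    rw [List.countP_map, Function.comp_def, hcard,
      ← Finset.card_map (Function.Embedding.subtype _)]
    congr 1
    ext e
    simp only [Finset.mem_map, Finset.mem_biUnion, Finset.mem_univ, true_and, Finset.mem_filter,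
      Function.Embedding.subtype_apply, List.mem_toFinset, List.mem_map, List.mem_filter,
      Option.isSome_iff_exists]
    constructor
    · rintro ⟨x, ⟨k, hx⟩, rfl⟩
      exact ⟨_, ⟨hx, k, rfl⟩, rfl⟩
    · rintro ⟨⟨e, c⟩, ⟨hx, k, rfl⟩, rfl⟩
      exact ⟨⟨e, hmem _ hx⟩, ⟨k, hx⟩, rfl⟩

end SetPartition

/-- `rowLen` is indexed from 0 and vanishes past the last row, matching λ'_1, …, λ'_r with zero
padding. -/
theorem corollary3p5 (n : ℕ) (P : Finpartition (Finset.Icc 1 n)) (r : ℕ) :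
    SetPartition.ne r P =
      ∑ i ∈ Finset.range r, (RSK.shape (SetPartition.alpha P)).transpose.rowLen i := by
  have hgreatest := RSK.isGreatest_hasDecreasingFamily r (SetPartition.alpha P)
  apply le_antisymm
  · refine Finset.sup_le fun C hC => hgreatest.2 ?_
    exact SetPartition.hasDecreasingFamily_of_isClique (Finset.mem_filter.1 hC).2
  · obtain ⟨C, hC, hcard⟩ := SetPartition.exists_isClique_of_hasDecreasingFamily hgreatest.1
    rw [← hcard]
    exact Finset.le_sup (f := fun C => (Finset.univ.biUnion C).card)
      (Finset.mem_filter.2 ⟨Finset.mem_univ C, hC⟩)
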